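/- Consider deterministic Turing machines with a read-only input tape over $\{0,1\}$ delimited by end markers and a finite number of two-way infinite work tapes. Let $\mathrm{P}$ be the class of languages $A\subseteq\{0,1\}^*$ decided by such a machine in a number of steps bounded by a polynomial in the input length, and let $\mathrm{L}$ be the class of languages decided by such a machine that, for some constant $c$, visits at most $c\,(\lfloor\log_2 m\rfloor+1)$ work-tape cells on every input of length $m\ge 1$ (and at most $c$ cells on the empty input). A garden-hose game with $s$ pipes for inputs $x,y\in\{0,1\}^n$ consists of the vertex sets $A_\circ=\{0,1^A,\dots,s^A\}$ (with the tap $0$) and $B=\{1^B,\dots,s^B\}$, and of functions $x\mapsto E_{A_\circ}(x)$ and $y\mapsto E_B(y)$ whose values are loop-free edge sets on $A_\circ$ and on $B$, respectively, of maximum degree at most $1$. Let $G(x,y)$ be the graph on $A_\circ\cup B$ with edge set $\{\{i^A,i^B\}:1\le i\le s\}\cup E_{A_\circ}(x)\cup E_B(y)$. The game computes $g:\{0,1\}^n\times\{0,1\}^n\to\{0,1\}$ if for all $x,y$ the unique maximal path of $G(x,y)$ starting at $0$ ends in $A_\circ$ when $g(x,y)=0$ and in $B$ when $g(x,y)=1$.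 The garden-hose complexity $GH(g)$ is the least number of pipes of a garden-hose game that computes $g$. Let $f=(f_n)_{n\ge 0}$ with $f_n:\{0,1\}^n\times\{0,1\}^n\to\{0,1\}$ be a family of functions such that (i) $f$ is in $\mathrm{P}$, that is, the language $\{xy : n\ge 0,\ x,y\in\{0,1\}^n,\ f_n(x,y)=1\}$ is in $\mathrm{P}$, and (ii) $f$ has superpolynomial garden-hose complexity, that is, there is no polynomial $p$ with $GH(f_n)\le p(n)$ for all $n$. If such a family $f$ exists, then $\mathrm{P}\ne \mathrm{L}$. -/

import Mathlib

namespace GardenHose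

/-! ### Turing machines with a read-only input tape and several work tapes -/

/-- What the input head sees: an end marker or an input bit. -/
inductive InSymbol where
  | leftEnd
  | bit (b : Bool)
  | rightEnd

/-- A head move. -/
inductive Move where
  | left
  | stay
  | right

/-- A deterministic Turing machine with a read-only input tape over `{0,1}` delimited by end
markers, and `k` read-write work tapes, infinite in both directions. A state `q` with
`halt q = some b` is a halting state with output `b`. In the other states, given the state, the
symbol under the input head and the symbols under the work heads, `δ` returns the next state, the
move of the input head, and for each work tape the symbol to write and the move of its head. -/
structure TM where
  k : ℕ
  State : Type
  Γ : Type
  [finState : Finite State]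
  [finΓ : Finite Γ]
  blank : Γ
  start : State
  halt : State → Option Bool
  δ : State → InSymbol → (Fin k → Γ) → State × Move × (Fin k → Γ × Move)

namespace TM

/-- The configurations of a machine; the input word is kept apart. -/
structure Cfg (M : TM) where
  state : M.State
  inPos : ℕ
  head : Fin M.k → ℤ
  tape : Fin M.k → ℤ → M.Γ

/-- The cells of the input tape: `0` holds the left end marker, `1, …, |w|` hold the word `w`, and
`|w| + 1` holds the right end marker. -/
def readInput (w : List Bool) : ℕ → InSymbol
  | 0 => .leftEnd
  | i + 1 => match w[i]? with
    | some b => .bit b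
    | none => .rightEnd

/-- The input head stays within the cells `0, …, n + 1`. -/
def moveInput (n : ℕ) : Move → ℕ → ℕ
  | .left, i => i - 1
  | .stay, i => i
  | .right, i => min (i + 1) (n + 1)

def moveWork : Move → ℤ → ℤ
  | .left, i => i - 1
  | .stay, i => i
  | .right, i => i + 1

variable (M : TM)

/-- The input head starts on the left end marker, the work tapes are blank. -/
def init : M.Cfg where
  state := M.start
  inPos := 0
  head := fun _ => 0
  tape := fun _ _ => M.blank

/-- One step on the input word `w`; a halted configuration does not change any more. -/
def step (w : List Bool) (c : M.Cfg) : M.Cfg :=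
  match M.halt c.state with
  | some _ => c
  | none =>
    let r := M.δ c.state (readInput w c.inPos) (fun i => c.tape i (c.head i))
    { state := r.1
      inPos := moveInput w.length r.2.1 c.inPos
      head := fun i => moveWork (r.2.2 i).2 (c.head i)
      tape := fun i => Function.update (c.tape i) (c.head i) (r.2.2 i).1 }

/-- The configuration after `t` steps on the input word `w`. -/
def run (w : List Bool) (t : ℕ) : M.Cfg := (M.step w)^[t] M.init

/-- After at most `t` steps on input `w`, the machine has halted with the correct answer to the
question whether `w ∈ A`. -/
def DecidesWithin (A : Language Bool) (w : List Bool) (t : ℕ) : Prop :=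
  ∃ b : Bool, M.halt (M.run w t).state = some b ∧ (b = true ↔ w ∈ A)

/-- The work tape cells (tape number and position) that are ever visited on the input word `w`. -/
def visited (w : List Bool) : Set (Fin M.k × ℤ) :=
  {c | ∃ t, (M.run w t).head c.1 = c.2}

end TM

/-- The class P: languages decided by a deterministic Turing machine in polynomial time. -/
def classP : Set (Language Bool) :=
  {A | ∃ (M : TM) (p : Polynomial ℕ), ∀ w, M.DecidesWithin A w (p.eval w.length)}

/-- The class L: languages decided by a deterministic Turing machine (halting on all inputs) that
visits `O(log n)` work tape cells on inputs of length `n`. The bound `c * (⌊log₂ n⌋ + 1)` rather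
than `c * log n` takes care of the lengths `n = 0, 1`. -/
def classL : Set (Language Bool) :=
  {A | ∃ (M : TM) (c : ℕ), ∀ w, (∃ t, M.DecidesWithin A w t) ∧
    (M.visited w).encard ≤ ((c * (Nat.log 2 w.length + 1) : ℕ) : ℕ∞)}

/-! ### The garden-hose game -/

/-- Maximum degree at most one: every vertex has at most one neighbour. -/
def MaxDegLeOne {V : Type*} (H : SimpleGraph V) : Prop :=
  ∀ u v w, H.Adj u v → H.Adj u w → v = w

/-- A garden-hose game with inputs in `{0,1}ⁿ × {0,1}ⁿ` and `s` pipes. Alice's vertices are the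
water tap `none` and her ends `some i` of the pipes, Bob's vertices are his ends `i` of the pipes.
`EA x` and `EB y` are the connections the players make depending on their own input. -/
structure Game (n s : ℕ) where
  EA : (Fin n → Bool) → SimpleGraph (Option (Fin s))
  EB : (Fin n → Bool) → SimpleGraph (Fin s)
  degA : ∀ x, MaxDegLeOne (EA x)
  degB : ∀ y, MaxDegLeOne (EB y)

/-- The adjacency relation of the graph consisting of the pipes and of both players' connections. -/
def joinAdj {s : ℕ} (HA : SimpleGraph (Option (Fin s))) (HB : SimpleGraph (Fin s)) :
    Option (Fin s) ⊕ Fin s → Option (Fin s) ⊕ Fin s → Prop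
  | .inl a, .inl b => HA.Adj a b
  | .inr a, .inr b => HB.Adj a b
  | .inl a, .inr j => a = some j
  | .inr j, .inl a => a = some j

namespace Game

variable {n s : ℕ}

/-- The graph `G(x, y)`. -/
def graph (G : Game n s) (x y : Fin n → Bool) : SimpleGraph (Option (Fin s) ⊕ Fin s) where
  Adj := joinAdj (G.EA x) (G.EB y)
  symm := ⟨by
    rintro (a | a) (b | b) h
    · exact (G.EA x).adj_symm h
    · exact h
    · exact h
    · exact (G.EB y).adj_symm h⟩
  loopless := ⟨by
    rintro (a | a) h
    · exact (G.EA x).irrefl h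
    · exact (G.EB y).irrefl h⟩

/-- The vertex of the water tap. -/
def tap : Option (Fin s) ⊕ Fin s := .inl none

end Game

/-- A path that cannot be prolonged at its end. -/
def IsMaximalPath {V : Type*} {H : SimpleGraph V} {u v : V} (p : H.Walk u v) : Prop :=
  p.IsPath ∧ ∀ w, H.Adj v w → w ∈ p.support

/-- The game computes `f`: for all inputs, the maximal path that starts at the tap (there is exactly
one, as the tap has degree at most one and all the other vertices have degree at most two) ends on
Alice's side if `f x y = 0` and on Bob's side if `f x y = 1`. -/
def Game.Computes {n s : ℕ} (G : Game n s) (f : (Fin n → Bool) → (Fin n → Bool) → Bool) : Prop :=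
  ∀ x y, ∃ (v : Option (Fin s) ⊕ Fin s) (p : (G.graph x y).Walk Game.tap v),
    IsMaximalPath p ∧ (f x y = false → v.isLeft = true) ∧ (f x y = true → v.isRight = true)

/-- Every Boolean function is computed by some garden-hose game. -/
theorem exists_computes {n : ℕ} (f : (Fin n → Bool) → (Fin n → Bool) → Bool) :
    ∃ s, ∃ G : Game n s, G.Computes f := by
  classical
  let e := Fintype.equivFin ((Fin n → Bool) × Bool)
  let G : Game n (Fintype.card ((Fin n → Bool) × Bool)) :=
    { EA := fun x => SimpleGraph.edge none (some (e (x, false)))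
      EB := fun y => SimpleGraph.fromRel fun i j =>
        ∃ x, f x y = false ∧ i = e (x, false) ∧ j = e (x, true)
      degA := by
        intro x u v w hv hw
        simp only [SimpleGraph.edge_adj] at hv hw
        grind
      degB := by
        intro y u v w hv hw
        simp only [SimpleGraph.fromRel_adj] at hv hw
        grind [e.injective.eq_iff] }
  refine ⟨_, G, fun x y => ?_⟩
  have h1 : (G.graph x y).Adj Game.tap (.inl (some (e (x, false)))) := by
    change (G.EA x).Adj _ _
    simp [G, SimpleGraph.edge_adj]
  have h2 : (G.graph x y).Adj (.inl (some (e (x, false)))) (.inr (e (x, false))) := rfl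
  cases hf : f x y with
  | true =>
    refine ⟨_, .cons h1 (.cons h2 .nil), ⟨?_, ?_⟩, by simp, by simp⟩
    · rw [SimpleGraph.Walk.isPath_def]
      change List.Nodup [Game.tap, .inl (some (e (x, false))), .inr (e (x, false))]
      simp [Game.tap]
    · rintro (a | a) h
      · change a = _ at h
        simp [h]
      · change (G.EB y).Adj _ _ at h
        simp only [G, SimpleGraph.fromRel_adj] at h
        grind [e.injective.eq_iff]
  | false =>
    have h3 : (G.graph x y).Adj (.inr (e (x, false))) (.inr (e (x, true))) := by
      change (G.EB y).Adj _ _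
      simp [G, SimpleGraph.fromRel_adj, hf]
    have h4 : (G.graph x y).Adj (.inr (e (x, true))) (.inl (some (e (x, true)))) := rfl
    refine ⟨_, .cons h1 (.cons h2 (.cons h3 (.cons h4 .nil))), ⟨?_, ?_⟩, by simp, by simp⟩
    · rw [SimpleGraph.Walk.isPath_def]
      change List.Nodup [Game.tap, .inl (some (e (x, false))), .inr (e (x, false)),
        .inr (e (x, true)), .inl (some (e (x, true)))]
      simp [Game.tap]
    · rintro (a | a) h
      · change (G.EA x).Adj _ _ at h
        simp [G, SimpleGraph.edge_adj] at h
      · change some _ = some a at h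
        simp at h
        simp [← h]

/-- The garden-hose complexity of `f`: the least number of pipes of a game that computes `f`. -/
noncomputable def gh {n : ℕ} (f : (Fin n → Bool) → (Fin n → Bool) → Bool) : ℕ :=
  sInf {s | ∃ G : Game n s, G.Computes f}

/-! ### Families of Boolean functions -/

/-- A function `f : {0,1}ⁿ × {0,1}ⁿ → {0,1}` for every `n`. -/
def BoolFamily : Type := ∀ n : ℕ, (Fin n → Bool) → (Fin n → Bool) → Bool

/-- The decision problem of `f`: the words `xy` with `|x| = |y|` and `f(x, y) = 1`. -/
def BoolFamily.language (f : BoolFamily) : Language Bool :=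
  {w | ∃ (n : ℕ) (x y : Fin n → Bool), w = List.ofFn x ++ List.ofFn y ∧ f n x y = true}

/-- The garden-hose complexity of `f` is not bounded by a polynomial in `n`. -/
def BoolFamily.SuperpolynomialGH (f : BoolFamily) : Prop :=
  ∀ p : Polynomial ℕ, ∃ n : ℕ, p.eval n < gh (f n)

end GardenHose

/-! Let `M` decide `f` in logarithmic space, so that only polynomially many configurations occur on
inputs of length `n`. The next configuration depends on the input bit under the input head, which is
known to one of the players. Hence the players can simulate `M` in turns, each of them making the
steps for which the head is on their own half of the input, until it is the turn of the player who
stands for the output. Every pair of a player to move and a configuration has at most one successor,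
so the pairs from which a final one is reached form a tree, with the successors as parents.

Such a tree cannot be laid out directly with pipes, as a vertex may have many children while a pipe
end has room for one hose. But the depth-first traversal of a tree is reversible, and from every
vertex it leads to the root. Its states, the edges of the tree with a direction, become the pipes.
What the traversal does around a vertex `u` depends only on the turns that lead to `u`;
all of these are made by the same player, who can therefore connect the pipes there. With the tap in
place of the pipe that leads into the initial vertex, the water follows the traversal up to the root
and comes out at the player who stands for the output. -/

namespace GardenHose

open Relation

section Graph

variable {V : Type*} {H : SimpleGraph V} {R : V → V → Prop} {u v : V}

theorem maxDegLeOne_fromRel (hR : Relator.BiUnique R) (hRR : ∀ a b c, R a b → ¬ R b c) :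
    MaxDegLeOne (SimpleGraph.fromRel R) := by
  rintro a b c ⟨-, hab | hba⟩ ⟨-, hac | hca⟩
  · exact hR.2 hab hac
  · exact absurd hab (hRR _ _ _ hca)
  · exact absurd hac (hRR _ _ _ hba)
  · exact hR.1 hba hca

theorem exists_isPath_of_reflTransGen (hRH : ∀ a b, R a b → H.Adj a b)
    (hR : Relator.LeftUnique R) (hu : ∀ a, ¬ R a u) (huv : ReflTransGen R u v) :
    ∃ p : H.Walk u v, p.IsPath ∧ ∀ b ∈ p.support, b ≠ u → ∃ a ∈ p.support, a ≠ v ∧ R a b := by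
  induction huv with
  | refl => exact ⟨.nil, .nil, by simp⟩
  | @tail v w _ hvw ih =>
    obtain ⟨p, hp, hpred⟩ := ih
    have hw : w ∉ p.support := by
      intro hw
      obtain ⟨a, -, hav, haw⟩ := hpred w hw (by rintro rfl; exact hu v hvw)
      exact hav (hR haw hvw)
    refine ⟨p.concat (hRH v w hvw), hp.concat hw (hRH v w hvw), fun b hb hbu => ?_⟩
    simp only [SimpleGraph.Walk.support_concat, List.mem_append, List.mem_singleton] at hb ⊢
    rcases hb with hb | rfl
    · obtain ⟨a, ha, -, hab⟩ := hpred b hb hbu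
      exact ⟨a, .inl ha, by rintro rfl; exact hw ha, hab⟩
    · exact ⟨v, .inl p.end_mem_support, (hRH v b hvw).ne, hvw⟩

theorem exists_isMaximalPath_of_reflTransGen (hRH : ∀ a b, H.Adj a b ↔ R a b ∨ R b a)
    (hR : Relator.LeftUnique R) (hu : ∀ a, ¬ R a u) (huv : ReflTransGen R u v)
    (hv : ∀ b, ¬ R v b) : ∃ p : H.Walk u v, IsMaximalPath p := by
  obtain ⟨p, hp, hpred⟩ :=
    exists_isPath_of_reflTransGen (fun a b hab => (hRH a b).2 (.inl hab)) hR hu huv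
  refine ⟨p, hp, fun b hvb => ?_⟩
  have hbv : R b v := ((hRH v b).1 hvb).resolve_left (hv b)
  obtain ⟨a, ha, -, hav⟩ := hpred v p.end_mem_support (by rintro rfl; exact hu b hbv)
  exact hR hbv hav ▸ ha

end Graph

/-- A garden-hose strategy with pipes `P` in which the direction of the water is fixed in advance.
The pipe `p` can only carry water towards the player `dest p`, where `false` is Alice and `true` is
Bob. When water arrives at the player `s` through `p`, it leaves through the pipe `q` with
`link s z p q`, where `z` is the input of `s`. On Alice's side the tap takes the place of the pipe
`start`, whose own end there stays loose. -/
structure DirectedGame (n : ℕ) (P : Type*) where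
  dest : P → Bool
  start : P
  link : Bool → (Fin n → Bool) → P → P → Prop
  dest_start : dest start = false
  dest_of_link : ∀ {s z p q}, link s z p q → dest p = s ∧ dest q = !s
  biUnique_link : ∀ s z, Relator.BiUnique (link s z)

namespace DirectedGame

variable {n : ℕ} {P Q : Type*}

/-- The passages of the water from one pipe to the next. -/
def Flow (G : DirectedGame n P) (x y : Fin n → Bool) (p q : P) : Prop :=
  ∃ s, G.link s (cond s y x) p q

/-- Alice's links after the replacement of the pipe `start` by the tap. -/
def AliceLink (G : DirectedGame n P) (x : Fin n → Bool) (a b : Option P) : Prop :=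
  a ≠ some G.start ∧ ∃ q, b = some q ∧ G.link false x (a.getD G.start) q

theorem link_link_false (G : DirectedGame n P) {s : Bool} {z : Fin n → Bool} {p q r : P}
    (hpq : G.link s z p q) : ¬ G.link s z q r := by
  intro hqr
  have h := (G.dest_of_link hpq).2.symm.trans (G.dest_of_link hqr).1
  exact Bool.not_ne_self s h

theorem biUnique_aliceLink (G : DirectedGame n P) (x : Fin n → Bool) :
    Relator.BiUnique (G.AliceLink x) := by
  constructor
  · rintro a b _ ⟨ha, q, rfl, haq⟩ ⟨hb, q', hq', hbq⟩
    obtain rfl := Option.some.inj hq'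
    have hab := (G.biUnique_link false x).1 haq hbq
    cases a <;> cases b <;> simp_all
  · rintro a _ _ ⟨-, q, rfl, haq⟩ ⟨-, q', rfl, haq'⟩
    rw [(G.biUnique_link false x).2 haq haq']

theorem aliceLink_aliceLink_false (G : DirectedGame n P) {x : Fin n → Bool} {a b c : Option P}
    (hab : G.AliceLink x a b) : ¬ G.AliceLink x b c := by
  obtain ⟨-, q, rfl, hq⟩ := hab
  rintro ⟨-, r, -, hr⟩
  exact G.link_link_false hq hr

/-- The garden-hose game in which the players follow a directed strategy. -/
def toGame {s : ℕ} (G : DirectedGame n (Fin s)) : Game n s where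
  EA x := SimpleGraph.fromRel (G.AliceLink x)
  EB y := SimpleGraph.fromRel (G.link true y)
  degA x := maxDegLeOne_fromRel (G.biUnique_aliceLink x) fun _ _ _ => G.aliceLink_aliceLink_false
  degB y := maxDegLeOne_fromRel (G.biUnique_link true y) fun _ _ _ => G.link_link_false

/-- The directed edges of the graph of the game: water at one end of a pipe moves on to the
other. -/
inductive Stream (G : DirectedGame n P) (x y : Fin n → Bool) :
    Option P ⊕ P → Option P ⊕ P → Prop
  | alice {a b} : G.AliceLink x a b → Stream G x y (.inl a) (.inl b)
  | bob {p q} : G.link true y p q → Stream G x y (.inr p) (.inr q)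
  | toAlice {p} : G.dest p = false → Stream G x y (.inr p) (.inl (some p))
  | toBob {p} : G.dest p = true → Stream G x y (.inl (some p)) (.inr p)

theorem toGame_graph_adj_iff {s : ℕ} (G : DirectedGame n (Fin s)) (x y : Fin n → Bool)
    (v w : Option (Fin s) ⊕ Fin s) :
    (G.toGame.graph x y).Adj v w ↔ G.Stream x y v w ∨ G.Stream x y w v := by
  have pipe (p : Fin s) : G.Stream x y (.inl (some p)) (.inr p) ∨
      G.Stream x y (.inr p) (.inl (some p)) := by
    cases hp : G.dest p
    exacts [.inr (.toAlice hp), .inl (.toBob hp)]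
  constructor
  · rcases v with a | p <;> rcases w with b | q
    · rintro ⟨-, hab | hba⟩
      exacts [.inl (.alice hab), .inr (.alice hba)]
    · rintro (rfl : a = some q)
      exact pipe q
    · rintro (rfl : b = some p)
      exact (pipe p).symm
    · rintro ⟨-, hpq | hqp⟩
      exacts [.inl (.bob hpq), .inr (.bob hqp)]
  · suffices h : ∀ v w, G.Stream x y v w → (G.toGame.graph x y).Adj v w from
      fun hvw => hvw.elim (h v w) fun hwv => (h w v hwv).symm
    rintro _ _ (hab | hpq | - | -)
    · exact ⟨by rintro rfl; exact G.aliceLink_aliceLink_false hab hab, .inl hab⟩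
    · exact ⟨by rintro rfl; exact G.link_link_false hpq hpq, .inl hpq⟩
    · rfl
    · rfl

theorem leftUnique_stream (G : DirectedGame n P) (x y : Fin n → Bool) :
    Relator.LeftUnique (G.Stream x y) := by
  rintro _ _ _ (h₁ | h₁ | h₁ | h₁) (h₂ | h₂ | h₂ | h₂)
  · rw [(G.biUnique_aliceLink x).1 h₁ h₂]
  · obtain ⟨-, q, hq, h⟩ := h₁
    obtain rfl := Option.some.inj hq
    simp [(G.dest_of_link h).2] at h₂
  · rw [(G.biUnique_link true y).1 h₁ h₂]
  · simp [(G.dest_of_link h₁).2] at h₂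
  · obtain ⟨-, q, hq, h⟩ := h₂
    obtain rfl := Option.some.inj hq
    simp [(G.dest_of_link h).2] at h₁
  · rfl
  · simp [(G.dest_of_link h₂).2] at h₁
  · rfl

theorem not_stream_tap (G : DirectedGame n P) {x y : Fin n → Bool} (v : Option P ⊕ P) :
    ¬ G.Stream x y v (.inl none) := by
  rintro (⟨-, q, hq, -⟩ | _)
  cases hq

/-- The vertex at which the water arrives when it has gone through the pipe `p`. -/
def outlet [DecidableEq P] (G : DirectedGame n P) (p : P) : Option P ⊕ P :=
  if p = G.start then .inl none else if G.dest p then .inr p else .inl (some p)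

section Outlet

variable [DecidableEq P] (G : DirectedGame n P) {x y : Fin n → Bool} {p q : P}

theorem isLeft_outlet : (G.outlet p).isLeft = !G.dest p := by
  unfold outlet
  split_ifs with hp hd
  · simp [hp, G.dest_start]
  · simp [hd]
  · simp [hd]

theorem reflTransGen_stream_outlet_of_link {s : Bool} (h : G.link s (cond s y x) p q)
    (hq : q ≠ G.start) : ReflTransGen (G.Stream x y) (G.outlet p) (G.outlet q) := by
  obtain ⟨hp, hqs⟩ := G.dest_of_link h
  cases s
  · have hout : G.Stream x y (G.outlet p) (.inl (some q)) := by
      unfold outlet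
      split_ifs with hps hd
      · exact .alice ⟨nofun, q, rfl, by simpa [← hps] using h⟩
      · exact absurd hd (by simp [hp])
      · exact .alice ⟨by simpa using hps, q, rfl, h⟩
    refine .head hout (.single ?_)
    simpa [outlet, hq, hqs] using Stream.toBob hqs
  · have hps : p ≠ G.start := by rintro rfl; simp [G.dest_start] at hp
    have hout : G.Stream x y (G.outlet p) (.inr q) := by
      simpa [outlet, hps, hp] using Stream.bob h
    refine .head hout (.single ?_)
    simpa [outlet, hq, hqs] using Stream.toAlice hqs

theorem reflTransGen_stream_outlet (h : ReflTransGen (G.Flow x y) G.start p) :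
    ReflTransGen (G.Stream x y) (.inl none) (G.outlet p) := by
  induction h with
  | refl => simp [outlet, ReflTransGen.refl]
  | @tail p q _ hpq ih =>
    obtain rfl | hq := eq_or_ne q G.start
    · simp [outlet, ReflTransGen.refl]
    · obtain ⟨s, hpq⟩ := hpq
      exact ih.trans (G.reflTransGen_stream_outlet_of_link hpq hq)

theorem not_stream_outlet (h : ∀ q, ¬ G.Flow x y p q) (v : Option P ⊕ P) :
    ¬ G.Stream x y (G.outlet p) v := by
  unfold outlet
  split_ifs with hps hd
  · rintro ⟨-, q, -, hq⟩
    exact h q ⟨false, hps ▸ hq⟩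
  · rintro (_ | hq | hd')
    · exact h _ ⟨true, hq⟩
    · simp [hd] at hd'
  · rintro (⟨-, q, -, hq⟩ | _ | _ | hd')
    · exact h q ⟨false, hq⟩
    · exact hd hd'

end Outlet

theorem toGame_computes {s : ℕ} (G : DirectedGame n (Fin s))
    {f : (Fin n → Bool) → (Fin n → Bool) → Bool}
    (h : ∀ x y, ∃ p, ReflTransGen (G.Flow x y) G.start p ∧ (∀ q, ¬ G.Flow x y p q) ∧
      G.dest p = f x y) : G.toGame.Computes f := by
  intro x y
  obtain ⟨p, hp, hsink, hdest⟩ := h x y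
  obtain ⟨w, hw⟩ := exists_isMaximalPath_of_reflTransGen (G.toGame_graph_adj_iff x y)
    (G.leftUnique_stream x y) G.not_stream_tap (G.reflTransGen_stream_outlet hp)
    (G.not_stream_outlet hsink)
  refine ⟨_, w, hw, fun hf => ?_, fun hf => ?_⟩
  · rw [isLeft_outlet, hdest, hf, Bool.not_false]
  · simp [← Sum.not_isLeft, isLeft_outlet, hdest, hf]

/-- The same strategy with the pipes renamed. -/
def comap (G : DirectedGame n P) (e : Q ≃ P) : DirectedGame n Q where
  dest := G.dest ∘ e
  start := e.symm G.start
  link s z p q := G.link s z (e p) (e q)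
  dest_start := by simp [G.dest_start]
  dest_of_link := G.dest_of_link
  biUnique_link s z :=
    ⟨fun _ _ _ h h' => e.injective ((G.biUnique_link s z).1 h h'),
      fun _ _ _ h h' => e.injective ((G.biUnique_link s z).2 h h')⟩

theorem gh_le_card [Fintype P] (G : DirectedGame n P)
    {f : (Fin n → Bool) → (Fin n → Bool) → Bool}
    (h : ∀ x y, ∃ p, ReflTransGen (G.Flow x y) G.start p ∧ (∀ q, ¬ G.Flow x y p q) ∧
      G.dest p = f x y) : gh f ≤ Fintype.card P := by
  let e := (Fintype.equivFin P).symm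
  refine Nat.sInf_le ⟨(G.comap e).toGame, toGame_computes _ fun x y => ?_⟩
  obtain ⟨p, hp, hsink, hdest⟩ := h x y
  refine ⟨e.symm p, hp.lift e.symm fun a b ⟨s, hab⟩ => ⟨s, ?_⟩,
    fun q ⟨s, hq⟩ => hsink (e q) ⟨s, ?_⟩, (congrArg G.dest (e.apply_symm_apply p)).trans hdest⟩
  · simpa [comap] using hab
  · simpa [comap] using hq

end DirectedGame

section Forest

variable {V : Type*} {R : V → V → Prop} {v r : V}

theorem acc_of_rightUnique_of_root [Finite V] (hR : Relator.RightUnique R) (hr : ∀ u, ¬ R r u) :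
    Acc R r := by
  rw [acc_iff_isEmpty_descending_chain]
  refine ⟨fun ⟨g, h0, hg⟩ => not_injective_infinite_finite g fun i => ?_⟩
  have hg0 (i : ℕ) : g 0 ≠ g (i + 1) := fun h => hr (g i) (h0 ▸ h ▸ hg i)
  induction i with
  | zero =>
    intro j h
    cases j with
    | zero => rfl
    | succ j => exact absurd h (hg0 j)
  | succ i ih =>
    intro j h
    cases j with
    | zero => exact absurd h.symm (hg0 i)
    | succ j => exact congrArg (· + 1) (ih (hR (h ▸ hg i) (hg j)))

theorem acc_of_reflTransGen (hr : Acc R r) (h : ReflTransGen R v r) : Acc R v := by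
  induction h using ReflTransGen.head_induction_on with
  | refl => exact hr
  | head h _ ih => exact ih.inv h

end Forest

section Tour

variable {V : Type*} [LinearOrder V] {R : V → V → Prop}

/-- The depth-first traversal of the forest in which `R c u` says that `u` is the parent of `c`. Its
states are the two directions of the edge above a vertex `v`: `(v, false)` leads down into the
subtree of `v`, and `(v, true)` leads back up to the parent of `v`. -/
inductive Tour (R : V → V → Prop) : V × Bool → V × Bool → Prop
  | leaf {u : V} : (∀ c, ¬ R c u) → Tour R (u, false) (u, true)
  | first {u c : V} : IsLeast {c | R c u} c → Tour R (u, false) (c, false)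
  | sibling {u c d : V} : R c u → IsLeast {d | R d u ∧ c < d} d → Tour R (c, true) (d, false)
  | last {u c : V} : IsGreatest {c | R c u} c → Tour R (c, true) (u, true)

namespace Tour

variable {u v r c : V}

theorem rightUnique (hR : Relator.RightUnique R) : Relator.RightUnique (Tour R) := by
  rintro _ _ _ (h | h | ⟨hc, h⟩ | h) (h' | h' | ⟨hc', h'⟩ | h')
  · rfl
  · exact absurd h'.1 (h _)
  · exact absurd h.1 (h' _)
  · rw [h.unique h']
  · obtain rfl := hR hc hc'
    rw [h.unique h']
  · obtain rfl := hR hc h'.1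
    exact absurd (h'.2 h.1.1) h.1.2.not_ge
  · obtain rfl := hR h.1 hc'
    exact absurd (h.2 h'.1.1) h'.1.2.not_ge
  · rw [hR h.1 h'.1]

theorem leftUnique (hR : Relator.RightUnique R) : Relator.LeftUnique (Tour R) := by
  rintro _ _ _ (h | h | ⟨hc, h⟩ | h) (h' | h' | ⟨hc', h'⟩ | h')
  · rfl
  · exact absurd h'.1 (h _)
  · rw [hR h.1 h'.1]
  · obtain rfl := hR h.1 h'.1.1
    exact absurd (h.2 hc') h'.1.2.not_ge
  · obtain rfl := hR h.1.1 h'.1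
    exact absurd (h'.2 hc) h.1.2.not_ge
  · obtain rfl := hR h.1.1 h'.1.1
    refine congrArg (·, true) (le_antisymm (not_lt.1 fun hlt => ?_) (not_lt.1 fun hlt => ?_))
    · exact absurd (h'.2 ⟨hc, hlt⟩) h.1.2.not_ge
    · exact absurd (h.2 ⟨hc', hlt⟩) h'.1.2.not_ge
  · exact absurd h.1 (h' _)
  · rw [h.unique h']

theorem biUnique (hR : Relator.RightUnique R) : Relator.BiUnique (Tour R) :=
  ⟨leftUnique hR, rightUnique hR⟩

theorem not_tour_root (hr : ∀ u, ¬ R r u) (q : V × Bool) : ¬ Tour R (r, true) q := by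
  rintro (_ | _ | ⟨hc, -⟩ | h)
  exacts [hr _ hc, hr _ h.1]

variable [Finite V]

theorem reflTransGen_up (hexc : ∀ c, R c u → ReflTransGen (Tour R) (c, false) (c, true))
    (hc : R c u) : ReflTransGen (Tour R) (c, true) (u, true) := by
  induction c using WellFoundedGT.induction with | ind c ih
  by_cases hlast : ∃ d, R d u ∧ c < d
  · obtain ⟨d, hd⟩ := exists_minimal_of_wellFoundedLT _ hlast
    have hd : IsLeast {d | R d u ∧ c < d} d := minimal_iff_isLeast.1 hd
    exact .head (.sibling hc hd) ((hexc d hd.1.1).trans (ih d hd.1.2 hd.1.1))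
  · exact .single (.last ⟨hc, fun d hd => not_lt.1 fun hcd => hlast ⟨d, hd, hcd⟩⟩)

theorem reflTransGen_excursion (hv : Acc R v) :
    ReflTransGen (Tour R) (v, false) (v, true) := by
  induction hv with | intro v _ ih
  by_cases hleaf : ∃ c, R c v
  · obtain ⟨c, hc⟩ := exists_minimal_of_wellFoundedLT _ hleaf
    have hc : IsLeast {c | R c v} c := minimal_iff_isLeast.1 hc
    exact .head (.first hc) ((ih c hc.1).trans (reflTransGen_up ih hc.1))
  · exact .single (.leaf (not_exists.1 hleaf))

theorem reflTransGen_ascent (hr : Acc R r) (h : ReflTransGen R v r) :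
    ReflTransGen (Tour R) (v, true) (r, true) := by
  induction h using ReflTransGen.head_induction_on with
  | refl => exact .refl
  | head hvu hur ih =>
    have hu := acc_of_reflTransGen hr hur
    exact (reflTransGen_up (fun c hc => reflTransGen_excursion (hu.inv hc)) hvu).trans ih

theorem reflTransGen_root (hR : Relator.RightUnique R) (hr : ∀ u, ¬ R r u)
    (h : ReflTransGen R v r) : ReflTransGen (Tour R) (v, false) (r, true) := by
  have hacc := acc_of_rightUnique_of_root hR hr
  exact (reflTransGen_excursion (acc_of_reflTransGen hacc h)).trans (reflTransGen_ascent hacc h)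

end Tour

end Tour

/-- A deterministic computation with states `V` that the two players carry out in turns. It is the
turn of the player `side v` (`false` is Alice, `true` is Bob) in the state `v`, and `turn s z v u`
says that the player `s` with the input `z` moves from `v` to `u`. -/
structure AlternatingProgram (n : ℕ) (V : Type*) where
  side : V → Bool
  start : V
  turn : Bool → (Fin n → Bool) → V → V → Prop
  side_start : side start = true
  side_of_turn : ∀ {s z v u}, turn s z v u → side v = s ∧ side u = !s
  rightUnique_turn : ∀ s z, Relator.RightUnique (turn s z)

namespace AlternatingProgram

variable {n : ℕ} {V : Type*} {A : AlternatingProgram n V} {x y : Fin n → Bool} {u v r : V}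

/-- The turns of both players. -/
def Step (A : AlternatingProgram n V) (x y : Fin n → Bool) (v u : V) : Prop :=
  ∃ s, A.turn s (cond s y x) v u

theorem rightUnique_step : Relator.RightUnique (A.Step x y) := by
  rintro v u u' ⟨s, h⟩ ⟨s', h'⟩
  obtain rfl := (A.side_of_turn h).1.symm.trans (A.side_of_turn h').1
  exact A.rightUnique_turn _ _ h h'

theorem side_of_step (h : A.Step x y v u) : A.side u = !A.side v := by
  obtain ⟨s, h⟩ := h
  rw [(A.side_of_turn h).1, (A.side_of_turn h).2]

theorem step_iff_turn {s : Bool} (hu : A.side u = !s) :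
    A.Step x y v u ↔ A.turn s (cond s y x) v u := by
  refine ⟨fun ⟨s', h⟩ => ?_, fun h => ⟨s, h⟩⟩
  obtain rfl := Bool.not_inj (hu.symm.trans (A.side_of_turn h).2)
  exact h

section LinearOrder

variable [LinearOrder V]

/-- The water follows the depth-first traversal of the forest of the turns. The part of the
traversal around a vertex `u` depends on the turns that lead to `u`, all of which are made by the
player who is not to move in `u`; this player connects the pipes there. -/
def toDirectedGame (A : AlternatingProgram n V) : DirectedGame n (V × Bool) where
  dest p := cond p.2 (A.side p.1) (!A.side p.1)
  start := (A.start, false)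
  link s z p q := cond p.2 (A.side p.1) (!A.side p.1) = s ∧ Tour (A.turn s z) p q
  dest_start := by simp [A.side_start]
  dest_of_link := by
    rintro s z p q ⟨hp, h⟩
    refine ⟨hp, ?_⟩
    rcases h with h | h | ⟨-, h⟩ | h
    · simpa using congrArg (!·) hp
    · simp [(A.side_of_turn h.1).1]
    · simp [(A.side_of_turn h.1.1).1]
    · simp [(A.side_of_turn h.1).2]
  biUnique_link s z :=
    have h := Tour.biUnique (A.rightUnique_turn s z)
    ⟨fun _ _ _ hp hq => h.1 hp.2 hq.2, fun _ _ _ hp hq => h.2 hp.2 hq.2⟩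

theorem flow_of_tour {p q : V × Bool} (h : Tour (A.Step x y) p q) :
    A.toDirectedGame.Flow x y p q := by
  rcases h with @⟨u, h⟩ | @⟨u, _, h⟩ | @⟨u, c, _, hc, h⟩ | @⟨u, c, h⟩
  · simp only [step_iff_turn (Bool.not_not (A.side u)).symm] at h
    exact ⟨!A.side u, rfl, .leaf h⟩
  · simp only [step_iff_turn (Bool.not_not (A.side u)).symm] at h
    exact ⟨!A.side u, rfl, .first h⟩
  · simp only [step_iff_turn (side_of_step hc)] at hc h
    exact ⟨A.side c, rfl, .sibling hc h⟩
  · simp only [step_iff_turn (side_of_step h.1)] at h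
    exact ⟨A.side c, rfl, .last h⟩

theorem not_flow_root (hr : ∀ u, ¬ A.Step x y r u) (q : V × Bool) :
    ¬ A.toDirectedGame.Flow x y (r, true) q := by
  rintro ⟨s, -, h⟩
  exact Tour.not_tour_root (fun u hu => hr u ⟨s, hu⟩) q h

end LinearOrder

theorem gh_le_two_mul_card [Fintype V] (A : AlternatingProgram n V)
    {f : (Fin n → Bool) → (Fin n → Bool) → Bool}
    (h : ∀ x y, ∃ r, ReflTransGen (A.Step x y) A.start r ∧ (∀ u, ¬ A.Step x y r u) ∧
      A.side r = f x y) : gh f ≤ 2 * Fintype.card V := by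
  let _ : LinearOrder V := LinearOrder.lift' (Fintype.equivFin V) (Fintype.equivFin V).injective
  refine (A.toDirectedGame.gh_le_card fun x y => ?_).trans_eq (by simp [Nat.mul_comm])
  obtain ⟨r, hr, hroot, hside⟩ := h x y
  have htour := Tour.reflTransGen_root (rightUnique_step) hroot hr
  exact ⟨(r, true), ReflTransGen.mono (fun _ _ => flow_of_tour) _ _ htour, not_flow_root hroot,
    hside⟩

end AlternatingProgram

namespace TM

variable {M : TM}

theorem step_congr {w w' : List Bool} {c : M.Cfg} (hlen : w.length = w'.length)
    (hread : readInput w c.inPos = readInput w' c.inPos) : M.step w c = M.step w' c := by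
  simp only [step, hlen, hread]

theorem readInput_append_left {u v v' : List Bool} {i : ℕ} (hi : i ≤ u.length) :
    readInput (u ++ v) i = readInput (u ++ v') i := by
  cases i with
  | zero => rfl
  | succ i => simp only [readInput, List.getElem?_append_left (show i < u.length from hi)]

theorem readInput_append_right {u u' v : List Bool} {i : ℕ} (hlen : u.length = u'.length)
    (hi : u.length < i) : readInput (u ++ v) i = readInput (u' ++ v) i := by
  cases i with
  | zero => omega
  | succ i =>
    simp only [readInput, List.getElem?_append_right (show u.length ≤ i by omega),
      List.getElem?_append_right (show u'.length ≤ i by omega), hlen]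

theorem run_succ (w : List Bool) (t : ℕ) : M.run w (t + 1) = M.step w (M.run w t) :=
  Function.iterate_succ_apply' _ _ _

theorem step_of_halt {w : List Bool} {c : M.Cfg} {b : Bool} (h : M.halt c.state = some b) :
    M.step w c = c := by
  simp [step, h]

theorem abs_moveWork_sub_le (m : Move) (z : ℤ) : |moveWork m z - z| ≤ 1 := by
  cases m <;> simp [moveWork]

theorem moveInput_le {n i : ℕ} (m : Move) (hi : i ≤ n + 1) : moveInput n m i ≤ n + 1 := by
  cases m <;> simp only [moveInput] <;> omega

theorem abs_head_step_sub_le (w : List Bool) (c : M.Cfg) (i : Fin M.k) :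
    |(M.step w c).head i - c.head i| ≤ 1 := by
  unfold step
  split
  · simp
  · exact abs_moveWork_sub_le _ _

theorem inPos_step_le {w : List Bool} {c : M.Cfg} (h : c.inPos ≤ w.length + 1) :
    (M.step w c).inPos ≤ w.length + 1 := by
  unfold step
  split
  · exact h
  · exact moveInput_le _ h

theorem tape_step_of_ne {w : List Bool} {c : M.Cfg} {i : Fin M.k} {z : ℤ} (h : z ≠ c.head i) :
    (M.step w c).tape i z = c.tape i z := by
  unfold step
  split
  · rfl
  · simp only [Function.update_of_ne h]

theorem inPos_run_le (w : List Bool) (t : ℕ) : (M.run w t).inPos ≤ w.length + 1 := by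
  induction t with
  | zero => exact Nat.zero_le _
  | succ t ih =>
    rw [run_succ]
    exact inPos_step_le ih

theorem mem_visited_of_mem_uIcc {w : List Bool} {t : ℕ} {i : Fin M.k} {z : ℤ}
    (hz : z ∈ Set.uIcc 0 ((M.run w t).head i)) : (i, z) ∈ M.visited w := by
  induction t with
  | zero =>
    have hz0 : z = 0 := by simpa [run, init] using hz
    exact ⟨0, hz0.symm⟩
  | succ t ih =>
    by_cases hzt : z ∈ Set.uIcc 0 ((M.run w t).head i)
    · exact ih hzt
    · have hmove := abs_head_step_sub_le w (M.run w t) i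
      rw [← run_succ, abs_le] at hmove
      rw [Set.mem_uIcc] at hz hzt
      have hpos : (M.run w (t + 1)).head i = z := by omega
      exact ⟨t + 1, hpos⟩

theorem abs_head_run_le {w : List Bool} {K : ℕ} (hK : (M.visited w).encard ≤ K) (t : ℕ)
    (i : Fin M.k) : |(M.run w t).head i| ≤ K := by
  have hsub : Prod.mk i '' Set.uIcc 0 ((M.run w t).head i) ⊆ M.visited w := by
    rintro _ ⟨z, hz, rfl⟩
    exact mem_visited_of_mem_uIcc hz
  have hcard := (Set.encard_le_encard hsub).trans hK
  rw [(Prod.mk_right_injective i).encard_image, ← Finset.coe_uIcc,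
    Set.encard_coe_eq_coe_finsetCard, Int.card_uIcc, Nat.cast_le] at hcard
  rw [abs_le]
  omega

theorem tape_run_eq_blank {w : List Bool} {K : ℕ} (hK : (M.visited w).encard ≤ K) (t : ℕ)
    (i : Fin M.k) {z : ℤ} (hz : (K : ℤ) < |z|) : (M.run w t).tape i z = M.blank := by
  induction t with
  | zero => rfl
  | succ t ih =>
    have hhead := abs_head_run_le hK t i
    rw [run_succ, tape_step_of_ne, ih]
    rintro rfl
    omega

/-- The configurations on inputs of length `m` in which only the work tape cells `-K, …, K` are
used. -/
def boundedCfg (M : TM) (m K : ℕ) : Set M.Cfg :=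
  {c | c.inPos ≤ m + 1 ∧ (∀ i, |c.head i| ≤ K) ∧
    ∀ i z, (K : ℤ) < |z| → c.tape i z = M.blank}

theorem run_mem_boundedCfg {w : List Bool} {K : ℕ} (hK : (M.visited w).encard ≤ K) (t : ℕ) :
    M.run w t ∈ M.boundedCfg w.length K :=
  ⟨inPos_run_le w t, fun i => abs_head_run_le hK t i, fun i _ hz => tape_run_eq_blank hK t i hz⟩

/-- The finite data that determine a bounded configuration, by which these are counted. -/
def boundedCfgCode (m K : ℕ) (c : M.boundedCfg m K) :
    M.State × Fin (m + 2) × (Fin M.k → Set.Icc (-K : ℤ) K) ×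
      (Fin M.k → Set.Icc (-K : ℤ) K → M.Γ) :=
  (c.1.state, ⟨c.1.inPos, Nat.lt_succ_of_le c.2.1⟩,
    fun i => ⟨c.1.head i, Set.mem_Icc.2 (abs_le.1 (c.2.2.1 i))⟩, fun i z => c.1.tape i z)

theorem boundedCfgCode_injective (m K : ℕ) :
    Function.Injective (boundedCfgCode (M := M) m K) := by
  rintro ⟨⟨q, p, h, T⟩, hc⟩ ⟨⟨q', p', h', T'⟩, hc'⟩ heq
  simp only [boundedCfgCode, Prod.mk.injEq, Fin.mk.injEq, funext_iff, Subtype.mk.injEq] at heq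
  obtain ⟨rfl, rfl, hhead, htape⟩ := heq
  obtain rfl : h = h' := funext hhead
  obtain rfl : T = T' := by
    funext i z
    by_cases hz : |z| ≤ K
    · exact htape i ⟨z, Set.mem_Icc.2 (abs_le.1 hz)⟩
    · exact (hc.2.2 i z (not_le.1 hz)).trans (hc'.2.2 i z (not_le.1 hz)).symm
  rfl

theorem finite_boundedCfg (m K : ℕ) : Finite (M.boundedCfg m K) := by
  have := M.finState
  have := M.finΓ
  exact Finite.of_injective _ (boundedCfgCode_injective m K)

theorem card_boundedCfg_le (m K : ℕ) :
    Nat.card (M.boundedCfg m K) ≤ Nat.card M.State * ((m + 2) *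
      ((2 * K + 1) ^ M.k * (Nat.card M.Γ ^ (2 * K + 1)) ^ M.k)) := by
  have := M.finState
  have := M.finΓ
  refine (Nat.card_le_card_of_injective _ (boundedCfgCode_injective m K)).trans_eq ?_
  have hI : Fintype.card (Set.Icc (-K : ℤ) K) = 2 * K + 1 := by
    rw [Fintype.card_ofFinset, Int.card_Icc]
    omega
  simp [Nat.card_prod, Nat.card_fun, hI]

end TM

theorem mem_language_iff (f : BoolFamily) {n : ℕ} (x y : Fin n → Bool) :
    List.ofFn x ++ List.ofFn y ∈ f.language ↔ f n x y = true := by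
  constructor
  · rintro ⟨n', x', y', h, hf⟩
    have hlen := congrArg List.length h
    simp only [List.length_append, List.length_ofFn] at hlen
    obtain rfl : n = n' := by omega
    obtain ⟨hx, hy⟩ := List.append_inj h (by simp)
    rwa [List.ofFn_injective hx, List.ofFn_injective hy]
  · exact fun h => ⟨n, x, y, rfl, h⟩

namespace TM

variable {M : TM} {n K : ℕ} {x y : Fin n → Bool}

/-- The attempt of the player `s`, who knows only the half `z` of the input, to carry out a step of
the machine. It fails if the input head is on the other half, where the left end marker counts as
part of Alice's half and the right end marker as part of Bob's half. The bits of the other half,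
which do not matter, are taken to be those of `z`. -/
def halfStep (M : TM) (s : Bool) (z : Fin n → Bool) (c : M.Cfg) : M.Cfg :=
  if decide (n < c.inPos) = s then M.step (List.ofFn z ++ List.ofFn z) c else c

theorem halfStep_of_eq {s : Bool} {c : M.Cfg} (hs : decide (n < c.inPos) = s) :
    M.halfStep s (cond s y x) c = M.step (List.ofFn x ++ List.ofFn y) c := by
  rw [halfStep, if_pos hs]
  cases s <;> refine step_congr (by simp) ?_
  · exact readInput_append_left (by simpa using hs)
  · exact readInput_append_right (by simp) (by simpa using hs)

theorem halfStep_of_ne {s : Bool} {z : Fin n → Bool} {c : M.Cfg} (hs : decide (n < c.inPos) ≠ s) :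
    M.halfStep s z c = c :=
  if_neg hs

theorem halfStep_of_halt {s b : Bool} {z : Fin n → Bool} {c : M.Cfg}
    (hc : M.halt c.state = some b) : M.halfStep s z c = c := by
  rw [halfStep, step_of_halt hc, ite_self]

theorem init_mem_boundedCfg (m K : ℕ) : M.init ∈ M.boundedCfg m K :=
  ⟨Nat.zero_le _, fun _ => by simp [init], fun _ _ _ => rfl⟩

/-- The simulation of a machine by the two players, who take turns and carry out a step whenever the
input head is on their own half of the input. The simulation ends on the side of the player who
stands for the output. -/
def program (M : TM) (n K : ℕ) : AlternatingProgram n (Bool × M.boundedCfg (n + n) K) where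
  side := Prod.fst
  start := (true, ⟨M.init, init_mem_boundedCfg _ _⟩)
  turn s z v u := v.1 = s ∧ u.1 = !s ∧ M.halt v.2.1.state ≠ some s ∧ u.2.1 = M.halfStep s z v.2.1
  side_start := rfl
  side_of_turn h := ⟨h.1, h.2.1⟩
  rightUnique_turn _ _ _ _ _ h h' :=
    Prod.ext (h.2.1.trans h'.2.1.symm) (Subtype.ext (h.2.2.2.trans h'.2.2.2.symm))

theorem program_step {s : Bool} {c c' : M.boundedCfg (n + n) K} (hs : M.halt c.1.state ≠ some s)
    (hc : c'.1 = M.halfStep s (cond s y x) c.1) :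
    (M.program n K).Step x y (s, c) (!s, c') :=
  ⟨s, rfl, rfl, hs, hc⟩

theorem exists_reflTransGen_program_step {c c' : M.boundedCfg (n + n) K}
    (hc : c'.1 = M.step (List.ofFn x ++ List.ofFn y) c.1) (s : Bool) :
    ∃ s', ReflTransGen ((M.program n K).Step x y) (s, c) (s', c') := by
  cases hhalt : M.halt c.1.state with
  | some b =>
    obtain rfl : c' = c := Subtype.ext (hc.trans (step_of_halt hhalt))
    exact ⟨s, .refl⟩
  | none =>
    have hne (s : Bool) : M.halt c.1.state ≠ some s := by simp [hhalt]
    by_cases hs : decide (n < c.1.inPos) = s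
    · exact ⟨!s, .single (program_step (hne s) (hc.trans (halfStep_of_eq hs).symm))⟩
    · have hs' : decide (n < c.1.inPos) = !s := Bool.eq_not_of_ne hs
      exact ⟨!!s, .head (program_step (hne s) (halfStep_of_ne hs).symm)
        (.single (program_step (hne !s) (hc.trans (halfStep_of_eq hs').symm)))⟩

theorem exists_reflTransGen_program_run
    (hrun : ∀ t, M.run (List.ofFn x ++ List.ofFn y) t ∈ M.boundedCfg (n + n) K) (t : ℕ) :
    ∃ s, ReflTransGen ((M.program n K).Step x y) (M.program n K).start (s, ⟨_, hrun t⟩) := by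
  induction t with
  | zero => exact ⟨true, .refl⟩
  | succ t ih =>
    obtain ⟨s, hs⟩ := ih
    obtain ⟨s', hs'⟩ := exists_reflTransGen_program_step
      (c := ⟨_, hrun t⟩) (c' := ⟨_, hrun (t + 1)⟩) (run_succ _ t) s
    exact ⟨s', hs.trans hs'⟩

theorem reflTransGen_program_of_halt {b : Bool} {c : M.boundedCfg (n + n) K}
    (hc : M.halt c.1.state = some b) (s : Bool) :
    ReflTransGen ((M.program n K).Step x y) (s, c) (b, c) := by
  obtain rfl | hs := eq_or_ne b s
  · exact .refl
  · obtain rfl := Bool.eq_not_of_ne hs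
    exact .single (program_step (by simp [hc]) (halfStep_of_halt hc).symm)

theorem not_program_step_of_halt {b : Bool} {c : M.boundedCfg (n + n) K}
    (hc : M.halt c.1.state = some b) (u : Bool × M.boundedCfg (n + n) K) :
    ¬ (M.program n K).Step x y (b, c) u := by
  rintro ⟨_, rfl, -, hhalt, -⟩
  exact hhalt hc

end TM

theorem gh_le_card_boundedCfg {M : TM} {n K : ℕ} {f : (Fin n → Bool) → (Fin n → Bool) → Bool}
    (hK : ∀ x y : Fin n → Bool, (M.visited (List.ofFn x ++ List.ofFn y)).encard ≤ K)
    (hf : ∀ x y, ∃ t, M.halt (M.run (List.ofFn x ++ List.ofFn y) t).state = some (f x y)) :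
    gh f ≤ 4 * Nat.card (M.boundedCfg (n + n) K) := by
  have := TM.finite_boundedCfg (M := M) (n + n) K
  have := Fintype.ofFinite (M.boundedCfg (n + n) K)
  refine ((M.program n K).gh_le_two_mul_card fun x y => ?_).trans_eq ?_
  · have hrun (t : ℕ) : M.run (List.ofFn x ++ List.ofFn y) t ∈ M.boundedCfg (n + n) K := by
      simpa using TM.run_mem_boundedCfg (hK x y) t
    obtain ⟨t, ht⟩ := hf x y
    obtain ⟨s, hs⟩ := TM.exists_reflTransGen_program_run hrun t
    exact ⟨(f x y, ⟨_, hrun t⟩), hs.trans (TM.reflTransGen_program_of_halt ht s),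
      TM.not_program_step_of_halt ht, rfl⟩
  · rw [Fintype.card_prod, Fintype.card_bool, Nat.card_eq_fintype_card, ← Nat.mul_assoc]

theorem pow_mul_log_add_one_le (a b m : ℕ) :
    a ^ (b * (Nat.log 2 m + 1)) ≤ (2 * m + 2) ^ (a * b) := by
  have hlog : 2 ^ (Nat.log 2 m + 1) ≤ 2 * m + 2 := by
    rw [pow_succ, Nat.mul_comm]
    have := Nat.pow_log_le_add_one 2 m
    omega
  calc a ^ (b * (Nat.log 2 m + 1))
      ≤ (2 ^ a) ^ (b * (Nat.log 2 m + 1)) := Nat.pow_le_pow_left Nat.lt_two_pow_self.le _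
    _ = (2 ^ (Nat.log 2 m + 1)) ^ (a * b) := by rw [← pow_mul, ← pow_mul]; ring_nf
    _ ≤ (2 * m + 2) ^ (a * b) := Nat.pow_le_pow_left hlog _

open Polynomial in
theorem exists_polynomial_card_boundedCfg_le (M : TM) (c : ℕ) :
    ∃ p : ℕ[X], ∀ m, Nat.card (M.boundedCfg m (c * (Nat.log 2 m + 1))) ≤ p.eval m := by
  let g := Nat.card M.Γ
  refine ⟨C (Nat.card M.State) * ((X + 2) * ((2 * (C c * (X + 1)) + 1) ^ M.k *
    (C g * (2 * X + 2) ^ (g * (2 * c))) ^ M.k)), fun m => ?_⟩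
  have hg : g ^ (2 * (c * (Nat.log 2 m + 1)) + 1) ≤ g * (2 * m + 2) ^ (g * (2 * c)) := by
    rw [pow_succ, Nat.mul_comm, ← Nat.mul_assoc]
    exact Nat.mul_le_mul_left g (pow_mul_log_add_one_le g (2 * c) m)
  simp only [eval_mul, eval_add, eval_pow, eval_C, eval_X, eval_ofNat, eval_one]
  refine (TM.card_boundedCfg_le _ _).trans ?_
  gcongr
  exact Nat.log_le_self 2 m

theorem not_superpolynomialGH_of_mem_classL {f : BoolFamily} (hf : f.language ∈ classL) :
    ¬ f.SuperpolynomialGH := by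
  obtain ⟨M, c, hM⟩ := hf
  obtain ⟨p, hp⟩ := exists_polynomial_card_boundedCfg_le M c
  have hgh (n : ℕ) : gh (f n) ≤ 4 * p.eval (n + n) := by
    refine (gh_le_card_boundedCfg (fun x y => ?_) fun x y => ?_).trans
      (Nat.mul_le_mul_left 4 (hp (n + n)))
    · simpa using (hM (List.ofFn x ++ List.ofFn y)).2
    · obtain ⟨t, b, hb, hiff⟩ := (hM (List.ofFn x ++ List.ofFn y)).1
      rw [mem_language_iff, ← Bool.eq_iff_iff] at hiff
      exact ⟨t, hiff ▸ hb⟩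
  intro hsuper
  obtain ⟨n, hn⟩ := hsuper (4 * p.comp (.X + .X))
  exact hn.not_ge (by simpa using hgh n)

end GardenHose

theorem mainTheorem4
    (h : ∃ f : GardenHose.BoolFamily,
      f.language ∈ GardenHose.classP ∧ f.SuperpolynomialGH) :
    GardenHose.classP ≠ GardenHose.classL := by
  obtain ⟨f, hP, hf⟩ := h
  exact fun heq => GardenHose.not_superpolynomialGH_of_mem_classL (heq ▸ hP) hf
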